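/- Write $\mathbb{N}^{\mathbb{N}}$ for Baire space and let $(\Phi_e)_{e\in\mathbb{N}}$ be an effective enumeration of the computable functionals $\Phi :\subseteq \mathbb{N}^{\mathbb{N}}\to\mathbb{N}^{\mathbb{N}}$: $\Phi_e(q)$ is defined iff the $e$-th oracle program with oracle $q$ halts on every $n\in\mathbb{N}$, and its value is then the function computed. For $A,B\subseteq\mathbb{N}^{\mathbb{N}}$, let $A\le_{\mathrm M}B$ (Medvedev reducibility) mean that some computable functional is defined on all of $B$ and maps $B$ into $A$; $A\equiv_{\mathrm M}B$ means $A\le_{\mathrm M}B$ and $B\le_{\mathrm M}A$. For $p\in\mathbb{N}^{\mathbb{N}}$ let $p^+:=\{\langle e\rangle^\smallfrown q : \Phi_e(q)=p \text{ and } q\not\le_{\mathrm T}p\}$, where $\le_{\mathrm T}$ is Turing reducibility. For partial multi-valued functions $f,g:\subseteq\mathbb{N}^{\mathbb{N}}\rightrightarrows\mathbb{N}^{\mathbb{N}}$ with $\operatorname{dom}(f)=\{p : f(p)\neq\emptyset\}$, let $f\le_{\mathrm W}g$ (Weihrauch reducibility) mean that there are computable functionals $\Phi,\Psi$ such that for every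 $p\in\operatorname{dom}(f)$, $\Phi(p)\in\operatorname{dom}(g)$ and $\Psi(p,q)\in f(p)$ for all $q\in g(\Phi(p))$. The Weihrauch degrees are the equivalence classes under mutual Weihrauch reducibility, partially ordered by $\le_{\mathrm W}$. In a partial order, $\mathbf a$ is a minimal cover of $\mathbf b$ if $\mathbf b<\mathbf a$ and there is no $\mathbf c$ with $\mathbf b<\mathbf c<\mathbf a$. **Corollary.** Let $h:\subseteq\mathbb{N}^{\mathbb{N}}\rightrightarrows\mathbb{N}^{\mathbb{N}}$ be a partial multi-valued function. If there is $p\in\mathbb{N}^{\mathbb{N}}$ with $\operatorname{dom}(h)\equiv_{\mathrm M}p^+$, then the Weihrauch degree of $h$ has exactly one minimal cover in the Weihrauch degrees. -/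

import Mathlib

/-- Programs with access to an oracle.  The constructors are those of `Nat.RecursiveIn`. -/
inductive OracleCode : Type
  | zero : OracleCode
  | succ : OracleCode
  | left : OracleCode
  | right : OracleCode
  | oracle : OracleCode
  | pair : OracleCode → OracleCode → OracleCode
  | comp : OracleCode → OracleCode → OracleCode
  | prec : OracleCode → OracleCode → OracleCode
  | rfind : OracleCode → OracleCode

namespace OracleCode

/-- The partial function computed by a program with oracle `g`, clause by clause as in
`Nat.RecursiveIn`. -/
def eval (g : ℕ → Part ℕ) : OracleCode → ℕ → Part ℕ
  | zero => fun _ => Part.some 0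
  | succ => fun n => Part.some (n + 1)
  | left => fun n => Part.some (Nat.unpair n).1
  | right => fun n => Part.some (Nat.unpair n).2
  | oracle => g
  | pair a b => fun n => Nat.pair <$> eval g a n <*> eval g b n
  | comp a b => fun n => eval g b n >>= eval g a
  | prec a b => fun p =>
      let (x, n) := Nat.unpair p
      n.rec (eval g a x) fun y IH => do
        let i ← IH
        eval g b (Nat.pair x (Nat.pair y i))
  | rfind a => fun x => Nat.rfind fun n => (fun m => m = 0) <$> eval g a (Nat.pair x n)

/-- The program with index `e`: an effective (surjective) numbering of all programs. -/
def ofIndex : ℕ → OracleCode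
  | 0 => zero
  | 1 => succ
  | 2 => left
  | 3 => right
  | 4 => oracle
  | e + 5 =>
    have h1 : (Nat.unpair (e / 4)).1 < e + 5 := by
      have := Nat.unpair_left_le (e / 4); omega
    have h2 : (Nat.unpair (e / 4)).2 < e + 5 := by
      have := Nat.unpair_right_le (e / 4); omega
    have h3 : e / 4 < e + 5 := by omega
    match e % 4 with
    | 0 => pair (ofIndex (Nat.unpair (e / 4)).1) (ofIndex (Nat.unpair (e / 4)).2)
    | 1 => comp (ofIndex (Nat.unpair (e / 4)).1) (ofIndex (Nat.unpair (e / 4)).2)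
    | 2 => prec (ofIndex (Nat.unpair (e / 4)).1) (ofIndex (Nat.unpair (e / 4)).2)
    | _ => rfind (ofIndex (e / 4))

/-- Every program has an index. -/
theorem ofIndex_surjective : Function.Surjective ofIndex := by
  intro c
  induction c with
  | zero => exact ⟨0, by simp [ofIndex]⟩
  | succ => exact ⟨1, by simp [ofIndex]⟩
  | left => exact ⟨2, by simp [ofIndex]⟩
  | right => exact ⟨3, by simp [ofIndex]⟩
  | oracle => exact ⟨4, by simp [ofIndex]⟩
  | pair a b iha ihb =>
    obtain ⟨i, rfl⟩ := iha
    obtain ⟨j, rfl⟩ := ihb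
    refine ⟨4 * Nat.pair i j + 5, ?_⟩
    rw [ofIndex]
    have h1 : (4 * Nat.pair i j) / 4 = Nat.pair i j := by omega
    have h2 : (4 * Nat.pair i j) % 4 = 0 := by omega
    rw [h1, h2]; simp
  | comp a b iha ihb =>
    obtain ⟨i, rfl⟩ := iha
    obtain ⟨j, rfl⟩ := ihb
    refine ⟨4 * Nat.pair i j + 1 + 5, ?_⟩
    rw [ofIndex]
    have h1 : (4 * Nat.pair i j + 1) / 4 = Nat.pair i j := by omega
    have h2 : (4 * Nat.pair i j + 1) % 4 = 1 := by omega
    rw [h1, h2]; simp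
  | prec a b iha ihb =>
    obtain ⟨i, rfl⟩ := iha
    obtain ⟨j, rfl⟩ := ihb
    refine ⟨4 * Nat.pair i j + 2 + 5, ?_⟩
    rw [ofIndex]
    have h1 : (4 * Nat.pair i j + 2) / 4 = Nat.pair i j := by omega
    have h2 : (4 * Nat.pair i j + 2) % 4 = 2 := by omega
    rw [h1, h2]; simp
  | rfind a iha =>
    obtain ⟨i, rfl⟩ := iha
    refine ⟨4 * i + 3 + 5, ?_⟩
    rw [ofIndex]
    have h1 : (4 * i + 3) / 4 = i := by omega
    have h2 : (4 * i + 3) % 4 = 3 := by omega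
    rw [h1, h2]; rfl

/-- Programs compute exactly the functions that are recursive in the oracle. -/
theorem recursiveIn_iff (g f : ℕ →. ℕ) : Nat.RecursiveIn {g} f ↔ ∃ c, eval g c = f := by
  constructor
  · intro hf
    induction hf with
    | zero => exact ⟨zero, rfl⟩
    | succ => exact ⟨succ, rfl⟩
    | left => exact ⟨left, rfl⟩
    | right => exact ⟨right, rfl⟩
    | oracle k hk => exact ⟨oracle, by rw [Set.mem_singleton_iff.1 hk]; rfl⟩
    | pair _ _ iha ihb =>
      obtain ⟨a, rfl⟩ := iha
      obtain ⟨b, rfl⟩ := ihb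
      exact ⟨pair a b, rfl⟩
    | comp _ _ iha ihb =>
      obtain ⟨a, rfl⟩ := iha
      obtain ⟨b, rfl⟩ := ihb
      exact ⟨comp a b, rfl⟩
    | prec _ _ iha ihb =>
      obtain ⟨a, rfl⟩ := iha
      obtain ⟨b, rfl⟩ := ihb
      exact ⟨prec a b, rfl⟩
    | rfind _ iha =>
      obtain ⟨a, rfl⟩ := iha
      exact ⟨rfind a, rfl⟩
  · rintro ⟨c, rfl⟩
    induction c with
    | zero => exact .zero
    | succ => exact .succ
    | left => exact .left
    | right => exact .right
    | oracle => exact .oracle _ rfl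
    | pair a b iha ihb => exact .pair iha ihb
    | comp a b iha ihb => exact .comp iha ihb
    | prec a b iha ihb => exact .prec iha ihb
    | rfind a iha => exact .rfind iha

/-- A partial recursive function is computed by one program, whatever the oracle. -/
theorem exists_of_partrec {f : ℕ → Part ℕ} (hf : Nat.Partrec f) : ∃ c, ∀ g, eval g c = f := by
  induction hf with
  | zero => exact ⟨zero, fun _ => rfl⟩
  | succ => exact ⟨succ, fun _ => rfl⟩
  | left => exact ⟨left, fun _ => rfl⟩
  | right => exact ⟨right, fun _ => rfl⟩
  | pair _ _ iha ihb =>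
    obtain ⟨a, ha⟩ := iha
    obtain ⟨b, hb⟩ := ihb
    exact ⟨pair a b, fun g => by simp only [eval, ha g, hb g]⟩
  | comp _ _ iha ihb =>
    obtain ⟨a, ha⟩ := iha
    obtain ⟨b, hb⟩ := ihb
    exact ⟨comp a b, fun g => by simp only [eval, ha g, hb g]⟩
  | prec _ _ iha ihb =>
    obtain ⟨a, ha⟩ := iha
    obtain ⟨b, hb⟩ := ihb
    exact ⟨prec a b, fun g => by simp only [eval, ha g, hb g]⟩
  | rfind _ iha =>
    obtain ⟨a, ha⟩ := iha
    exact ⟨rfind a, fun g => by simp only [eval, ha g]⟩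

/-- Replace every oracle call of the first program by a run of the second. -/
def subst (d : OracleCode) : OracleCode → OracleCode
  | oracle => d
  | pair a b => pair (subst d a) (subst d b)
  | comp a b => comp (subst d a) (subst d b)
  | prec a b => prec (subst d a) (subst d b)
  | rfind a => rfind (subst d a)
  | zero => zero
  | succ => succ
  | left => left
  | right => right

theorem eval_subst (g : ℕ → Part ℕ) (d c : OracleCode) :
    eval g (subst d c) = eval (eval g d) c := by
  induction c with
  | zero | succ | left | right | oracle => rfl
  | pair a b iha ihb => simp only [subst, eval, iha, ihb]
  | comp a b iha ihb => simp only [subst, eval, iha, ihb]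
  | prec a b iha ihb => simp only [subst, eval, iha, ihb]
  | rfind a iha => simp only [subst, eval, iha]

end OracleCode

/-- Baire space `ℕ^ℕ`. -/
abbrev Baire : Type := ℕ → ℕ

namespace Baire

/-- The `e`-th computable functional `Φ_e :⊆ ℕ^ℕ → ℕ^ℕ`.  It is defined at `q` iff the `e`-th
program with oracle `q` halts on every input, and its value is then the function computed. -/
def Φ (e : ℕ) : Baire →. Baire := fun q =>
  ⟨∀ n, ((OracleCode.ofIndex e).eval (fun k => Part.some (q k)) n).Dom,
    fun h n => ((OracleCode.ofIndex e).eval (fun k => Part.some (q k)) n).get (h n)⟩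

/-- The concatenation `⟨e⟩⌢q`. -/
def cons (e : ℕ) (q : Baire) : Baire
  | 0 => e
  | n + 1 => q n

/-- The interleaving `p ⊕ q`, the standard pairing on Baire space. -/
def join (p q : Baire) : Baire := fun n => if n % 2 = 0 then p (n / 2) else q (n / 2)

/-- Turing reducibility `q ≤_T p` on Baire space. -/
def TuringLE (q p : Baire) : Prop :=
  TuringReducible (PFun.lift q) (PFun.lift p)

/-- `p⁺ = {⟨e⟩⌢q : Φ_e(q) = p and q ≰_T p}`. -/
def succSet (p : Baire) : Set Baire :=
  {r | ∃ (e : ℕ) (q : Baire), r = cons e q ∧ p ∈ Φ e q ∧ ¬ TuringLE q p}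

theorem mem_Φ {e : ℕ} {q r : Baire} :
    r ∈ Φ e q ↔
      (OracleCode.ofIndex e).eval (fun k => Part.some (q k)) = fun n => Part.some (r n) := by
  constructor
  · rintro ⟨h, rfl⟩
    funext n
    exact (Part.some_get (h n)).symm
  · intro h
    refine ⟨fun n => by rw [h]; trivial, ?_⟩
    funext n
    simp [Φ, h]

/-- `A` is Medvedev reducible to `B`: some computable functional is defined on all of `B` and
maps `B` into `A`. -/
def MedvedevLE (A B : Set Baire) : Prop :=
  ∃ e : ℕ, ∀ q ∈ B, ∃ p ∈ Φ e q, p ∈ A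

/-- Medvedev equivalence. -/
def MedvedevEquiv (A B : Set Baire) : Prop := MedvedevLE A B ∧ MedvedevLE B A

end Baire

/-- Partial multi-valued functions on Baire space; `f p` is the set of values at `p`, which is
empty iff `f` is not defined at `p`. -/
def Problem : Type := Baire → Set Baire

namespace Problem

open Baire

/-- The domain of a partial multi-valued function. -/
def dom (f : Problem) : Set Baire := {p | (f p).Nonempty}

/-- Weihrauch reducibility, with forward functional `Φ_d` and backward functional `Φ_e`. -/
def WeihrauchLE (f g : Problem) : Prop :=
  ∃ d e : ℕ, ∀ p ∈ f.dom, ∃ p' ∈ Φ d p, p' ∈ g.dom ∧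
    ∀ q ∈ g p', ∃ r ∈ Φ e (join p q), r ∈ f p

theorem exists_leftProj : ∃ c : OracleCode, ∀ p q : Baire,
    c.eval (fun k => Part.some (join p q k)) = fun n => Part.some (p n) := by
  have hf : Nat.Partrec (fun n => Part.some (2 * n)) :=
    Nat.Partrec.of_primrec (Primrec.nat_iff.1 (Primrec.nat_mul.comp (.const 2) .id))
  obtain ⟨c, hc⟩ := OracleCode.exists_of_partrec hf
  refine ⟨.comp .oracle c, fun p q => ?_⟩
  funext n
  simp [OracleCode.eval, hc, join]

theorem exists_rightProj : ∃ c : OracleCode, ∀ p q : Baire,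
    c.eval (fun k => Part.some (join p q k)) = fun n => Part.some (q n) := by
  have hf : Nat.Partrec (fun n => Part.some (2 * n + 1)) :=
    Nat.Partrec.of_primrec (Primrec.nat_iff.1
      (Primrec.succ.comp (Primrec.nat_mul.comp (.const 2) .id)))
  obtain ⟨c, hc⟩ := OracleCode.exists_of_partrec hf
  refine ⟨.comp .oracle c, fun p q => ?_⟩
  funext n
  have h1 : (2 * n + 1) % 2 = 1 := by omega
  have h2 : (2 * n + 1) / 2 = n := by omega
  simp [OracleCode.eval, hc, join, h1, h2]

theorem exists_joinCode (a b : OracleCode) : ∃ c : OracleCode, ∀ (g : ℕ → Part ℕ) (p q : Baire),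
    a.eval g = (fun n => Part.some (p n)) → b.eval g = (fun n => Part.some (q n)) →
    c.eval g = fun n => Part.some (join p q n) := by
  have hhalf : Nat.Partrec (fun n => Part.some (n / 2)) :=
    Nat.Partrec.of_primrec (Primrec.nat_iff.1 (Primrec.nat_div.comp .id (.const 2)))
  have hid : Nat.Partrec (fun n => Part.some n) :=
    Nat.Partrec.of_primrec (Primrec.nat_iff.1 .id)
  have hcond : Nat.Partrec (fun n => Part.some (if n.unpair.1 % 2 = 0
      then n.unpair.2.unpair.1 else n.unpair.2.unpair.2)) := by
    refine Nat.Partrec.of_primrec (Primrec.nat_iff.1 ?_)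
    have h1 : Primrec (fun n : ℕ => n.unpair.1) := Primrec.fst.comp Primrec.unpair
    have h2 : Primrec (fun n : ℕ => n.unpair.2) := Primrec.snd.comp Primrec.unpair
    exact Primrec.ite (Primrec.eq.comp (Primrec.nat_mod.comp h1 (.const 2)) (.const 0))
      (h1.comp h2) (h2.comp h2)
  obtain ⟨half, hhalf⟩ := OracleCode.exists_of_partrec hhalf
  obtain ⟨idc, hid⟩ := OracleCode.exists_of_partrec hid
  obtain ⟨cond, hcond⟩ := OracleCode.exists_of_partrec hcond
  refine ⟨.comp cond (.pair idc (.pair (.comp a half) (.comp b half))), fun g p q ha hb => ?_⟩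
  funext n
  simp [OracleCode.eval, hhalf, hid, hcond, ha, hb, join, Seq.seq]

theorem WeihrauchLE.refl (f : Problem) : WeihrauchLE f f := by
  obtain ⟨d, hd⟩ := OracleCode.ofIndex_surjective .oracle
  obtain ⟨c, hc⟩ := exists_rightProj
  obtain ⟨e, rfl⟩ := OracleCode.ofIndex_surjective c
  refine ⟨d, e, fun p hp => ⟨p, ?_, hp, fun q hq => ⟨q, mem_Φ.2 (hc p q), hq⟩⟩⟩
  rw [mem_Φ, hd]
  rfl

theorem WeihrauchLE.trans {f g k : Problem} (hfg : WeihrauchLE f g) (hgk : WeihrauchLE g k) :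
    WeihrauchLE f k := by
  obtain ⟨d₁, e₁, h₁⟩ := hfg
  obtain ⟨d₂, e₂, h₂⟩ := hgk
  obtain ⟨l, hl⟩ := exists_leftProj
  obtain ⟨r, hr⟩ := exists_rightProj
  -- the program for `p ⊕ s ↦ Φ_{d₁}(p) ⊕ s`
  obtain ⟨m, hm⟩ := exists_joinCode (OracleCode.subst l (.ofIndex d₁)) r
  -- the program for `p ⊕ s ↦ p ⊕ Φ_{e₂}(Φ_{d₁}(p) ⊕ s)`
  obtain ⟨j, hj⟩ := exists_joinCode l (OracleCode.subst m (.ofIndex e₂))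
  obtain ⟨d, hd⟩ := OracleCode.ofIndex_surjective
    (OracleCode.subst (.ofIndex d₁) (.ofIndex d₂))
  obtain ⟨e, he⟩ := OracleCode.ofIndex_surjective (OracleCode.subst j (.ofIndex e₁))
  refine ⟨d, e, fun p hp => ?_⟩
  obtain ⟨p', hp', hp'dom, H₁⟩ := h₁ p hp
  obtain ⟨p'', hp'', hp''dom, H₂⟩ := h₂ p' hp'dom
  refine ⟨p'', ?_, hp''dom, fun s hs => ?_⟩
  · rw [mem_Φ, hd, OracleCode.eval_subst, mem_Φ.1 hp', mem_Φ.1 hp'']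
  · obtain ⟨t, ht, htg⟩ := H₂ s hs
    obtain ⟨u, hu, huf⟩ := H₁ t htg
    refine ⟨u, ?_, huf⟩
    rw [mem_Φ, he, OracleCode.eval_subst, hj _ p t (hl p s), mem_Φ.1 hu]
    rw [OracleCode.eval_subst, hm _ p' s _ (hr p s), mem_Φ.1 ht]
    rw [OracleCode.eval_subst, hl, mem_Φ.1 hp']

/-- Problems are preordered by Weihrauch reducibility. -/
instance : Preorder Problem where
  le := WeihrauchLE
  le_refl := WeihrauchLE.refl
  le_trans _ _ _ := WeihrauchLE.trans

end Problem

/-- The partial order of Weihrauch degrees. -/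
abbrev WeihrauchDegree : Type := Antisymmetrization Problem (· ≤ ·)

/-- The Weihrauch degree of a problem. -/
def Problem.degree (f : Problem) : WeihrauchDegree := toAntisymmetrization (· ≤ ·) f

/-! Let `point x` be the problem whose only instance is `x` and for which every answer is correct.
Then `point x ≤ h` says exactly that `x` computes an instance of `h`. Under the hypothesis on `p`
this holds iff `x` lies strictly above `p` in the Turing degrees. In particular `point p ≰ h`, and
the unique minimal cover of `h` is `h ⊔ point p`.

It is a cover (`covBy_coprod_point`): let `h ≤ g ≤ h ⊔ point p` with `point p ≰ g`. An instance `z`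
of `g` that is sent to the instance `p` computes `p` by a fixed program, and `z ≰_T p`. So `z`
yields an element of `p⁺`, hence an instance of `h`; the answer to `p` is arbitrary and can be
replaced by zeros. Thus `g ≤ h`.

It is the only one (`equiv_coprod_point_of_covBy`): let `g` be a minimal cover, so that `g ≤ h ⊔ k`
for every `k ≤ g` with `k ≰ h`. Three strictly intermediate problems are excluded in turn. A Baire
category argument splits any family of instances that reduce to `h` singly but not uniformly, so one
instance `x` with its solution set is already irreducible to `h` (`exists_single_of_covBy`). If `x`
computed an instance of `h`, adding one spurious constant solution to each of countably many copies
of `x` would give a problem in between (`exists_between_of_point_le`), so `point x ≰ h`. If `x ≰_T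
p`, then `p ≰_T x`, and cone avoidance gives `y ≰_T x` with `p ≰_T x ⊕ y`; then `point (x ⊕ y)` is
in between. Hence `x ≤_T p`, and `point p ≤ point x ≤ g`. -/

namespace Baire

/-! ### Programs as computable functionals, and basic constructions with them -/

/-- The program `c` with oracle `p` computes `q`. -/
def Computes (c : OracleCode) (p q : Baire) : Prop :=
  c.eval (fun k => Part.some (p k)) = fun n => Part.some (q n)

theorem Computes.unique {c : OracleCode} {p q r : Baire} (hq : Computes c p q)
    (hr : Computes c p r) : q = r := by
  funext n
  exact Part.some_injective (congrFun (hq.symm.trans hr) n)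

theorem Computes.subst {a b : OracleCode} {p q r : Baire} (ha : Computes a p q)
    (hb : Computes b q r) : Computes (a.subst b) p r := by
  unfold Computes at *
  rw [OracleCode.eval_subst, ha, hb]

theorem computes_oracle (p : Baire) : Computes .oracle p p := rfl

theorem turingLE_iff {p q : Baire} : TuringLE q p ↔ ∃ c, Computes c p q :=
  RecursiveIn.iff_nat.trans (OracleCode.recursiveIn_iff _ _)

theorem Computes.turingLE {c : OracleCode} {p q : Baire} (hc : Computes c p q) : TuringLE q p :=
  turingLE_iff.2 ⟨c, hc⟩

theorem TuringLE.trans {p q r : Baire} (hpq : TuringLE p q) (hqr : TuringLE q r) :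
    TuringLE p r := by
  obtain ⟨a, ha⟩ := turingLE_iff.1 hpq
  obtain ⟨b, hb⟩ := turingLE_iff.1 hqr
  exact (hb.subst ha).turingLE

theorem medvedevLE_iff {A B : Set Baire} :
    MedvedevLE A B ↔ ∃ c, ∀ q ∈ B, ∃ p, Computes c q p ∧ p ∈ A := by
  constructor
  · rintro ⟨e, he⟩
    refine ⟨.ofIndex e, fun q hq => ?_⟩
    obtain ⟨p, hp, hpA⟩ := he q hq
    exact ⟨p, mem_Φ.1 hp, hpA⟩
  · rintro ⟨c, hc⟩
    obtain ⟨e, rfl⟩ := OracleCode.ofIndex_surjective c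
    refine ⟨e, fun q hq => ?_⟩
    obtain ⟨p, hp, hpA⟩ := hc q hq
    exact ⟨p, mem_Φ.2 hp, hpA⟩

@[simp] theorem cons_zero (e : ℕ) (q : Baire) : cons e q 0 = e := rfl

@[simp] theorem cons_succ (e n : ℕ) (q : Baire) : cons e q (n + 1) = q n := rfl

theorem cons_inj {m n : ℕ} {p q : Baire} : cons m p = cons n q ↔ m = n ∧ p = q := by
  constructor
  · intro h
    exact ⟨congrFun h 0, funext fun k => congrFun h (k + 1)⟩
  · rintro ⟨rfl, rfl⟩
    rfl

theorem eq_cons (p : Baire) : p = cons (p 0) fun n => p (n + 1) := by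
  funext n
  cases n <;> rfl

theorem exists_tailCode : ∃ c, ∀ n p, Computes c (cons n p) p :=
  ⟨.comp .oracle .succ, fun n p => by
    funext k
    simp [OracleCode.eval]⟩

theorem exists_consCode (n : ℕ) : ∃ c, ∀ p, Computes c p (cons n p) := by
  have hcond : Nat.Partrec (fun k => Part.some (if k.unpair.1 = 0 then n else k.unpair.2)) := by
    refine Nat.Partrec.of_primrec (Primrec.nat_iff.1 ?_)
    have h1 : Primrec (fun n : ℕ => n.unpair.1) := Primrec.fst.comp Primrec.unpair
    have h2 : Primrec (fun n : ℕ => n.unpair.2) := Primrec.snd.comp Primrec.unpair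
    exact Primrec.ite (Primrec.eq.comp h1 (.const 0)) (.const n) h2
  obtain ⟨cond, hcond⟩ := OracleCode.exists_of_partrec hcond
  obtain ⟨idc, hid⟩ := OracleCode.exists_of_partrec
    (Nat.Partrec.of_primrec (Primrec.nat_iff.1 .id) : Nat.Partrec (fun n => Part.some n))
  obtain ⟨prd, hprd⟩ := OracleCode.exists_of_partrec
    (Nat.Partrec.of_primrec (Primrec.nat_iff.1 .pred) :
      Nat.Partrec (fun n => Part.some n.pred))
  refine ⟨.comp cond (.pair idc (.comp .oracle prd)), fun p => ?_⟩
  funext k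
  cases k <;> simp [OracleCode.eval, hcond, hid, hprd, Seq.seq]

theorem exists_constCode (n : ℕ) : ∃ c, ∀ p, Computes c p fun _ => n := by
  obtain ⟨c, hc⟩ := OracleCode.exists_of_partrec
    (Nat.Partrec.of_primrec (Primrec.nat_iff.1 (.const n)) :
      Nat.Partrec (fun _ => Part.some n))
  exact ⟨c, fun p => hc _⟩

theorem exists_leftCode : ∃ c, ∀ p q, Computes c (join p q) p := Problem.exists_leftProj

theorem exists_rightCode : ∃ c, ∀ p q, Computes c (join p q) q := Problem.exists_rightProj

theorem exists_computes_join (a b : OracleCode) : ∃ c, ∀ r p q, Computes a r p → Computes b r q →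
    Computes c r (join p q) := by
  obtain ⟨c, hc⟩ := Problem.exists_joinCode a b
  exact ⟨c, fun r p q => hc _ p q⟩

/-- Definition by cases on the first value of the oracle; only the relevant program is run. -/
theorem exists_iteCode (n : ℕ) (a b : OracleCode) : ∃ c, ∀ p q,
    (p 0 = n → Computes a p q → Computes c p q) ∧
    (p 0 ≠ n → Computes b p q → Computes c p q) := by
  have prim {f : ℕ → ℕ} (hf : Primrec f) : ∃ c : OracleCode, ∀ g, c.eval g =
      fun k => Part.some (f k) :=
    OracleCode.exists_of_partrec (Nat.Partrec.of_primrec (Primrec.nat_iff.1 hf))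
  obtain ⟨zc, hz⟩ := prim (Primrec.const 0)
  obtain ⟨idc, hid⟩ := prim Primrec.id
  obtain ⟨t, ht⟩ := prim (Primrec.ite (Primrec.eq.comp .id (.const n)) (.const 1) (.const 0) :
    Primrec fun k : ℕ => if k = n then 1 else 0)
  obtain ⟨t', ht'⟩ := prim (Primrec.ite (Primrec.eq.comp .id (.const n)) (.const 0) (.const 1) :
    Primrec fun k : ℕ => if k = n then 0 else 1)
  obtain ⟨add, hadd⟩ := prim (Primrec.nat_add.comp (Primrec.fst.comp Primrec.unpair)
    (Primrec.snd.comp Primrec.unpair) : Primrec fun k : ℕ => k.unpair.1 + k.unpair.2)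
  -- A primitive recursion of length `s (p 0)`, which is 0 or 1: length 0 returns 0 without running
  -- `d`, length 1 runs `d` once on the input. The sum of the two guarded runs is the wanted value.
  let guarded (s d : OracleCode) : OracleCode :=
    .comp (.prec zc (.comp d .left)) (.pair idc (.comp s (.comp .oracle zc)))
  refine ⟨.comp add (.pair (guarded t a) (guarded t' b)), fun p q => ⟨fun hp h => ?_,
    fun hp h => ?_⟩⟩
  all_goals
    funext k
    have hk := congrFun h k
    simp [guarded, OracleCode.eval, hz, hid, ht, ht', hadd, hp, hk, Seq.seq]

end Baire

/-! ### Evaluation from finite pieces of the oracle (use principle) -/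

namespace OracleCode

/-- One step of a bounded search: `0` means that nothing has been found yet, and `m + 1` that
`m` has been found. -/
def searchStep (f : ℕ → Option ℕ) (n st : ℕ) : Option ℕ :=
  if st = 0 then (f n).map fun v => if v = 0 then n + 1 else 0 else some st

/-- The state of the search for a zero of `f` after the inputs below `n`. -/
def search (f : ℕ → Option ℕ) (n : ℕ) : Option ℕ :=
  n.rec (some 0) fun n st => st.bind (searchStep f n)

/-- Evaluation with a finite piece `σ` of the oracle, whose length also bounds all searches. -/
def evalFin (σ : List ℕ) : OracleCode → ℕ → Option ℕ
  | zero => fun _ => some 0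
  | succ => fun n => some (n + 1)
  | left => fun n => some n.unpair.1
  | right => fun n => some n.unpair.2
  | oracle => fun n => σ[n]?
  | pair a b => fun n => (evalFin σ a n).bind fun u => (evalFin σ b n).map (Nat.pair u)
  | comp a b => fun n => (evalFin σ b n).bind (evalFin σ a)
  | prec a b => fun p => p.unpair.2.rec (evalFin σ a p.unpair.1) fun y IH =>
      IH.bind fun i => evalFin σ b (Nat.pair p.unpair.1 (Nat.pair y i))
  | rfind a => fun x => (search (fun n => evalFin σ a (Nat.pair x n)) σ.length).bind fun st =>
      if st = 0 then none else some (st - 1)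

/-- With all searches bounded by the length of `σ`, evaluation is total with values in `Option`;
this is what lets a program search through finite oracles. -/
theorem primrec_evalFin (c : OracleCode) : Primrec₂ fun σ n => evalFin σ c n := by
  have u1 : Primrec (fun n : ℕ => n.unpair.1) := Primrec.fst.comp Primrec.unpair
  have u2 : Primrec (fun n : ℕ => n.unpair.2) := Primrec.snd.comp Primrec.unpair
  induction c with
  | zero => exact Primrec.const _
  | succ => exact Primrec.option_some.comp (Primrec.succ.comp Primrec.snd)
  | left => exact Primrec.option_some.comp (u1.comp Primrec.snd)
  | right => exact Primrec.option_some.comp (u2.comp Primrec.snd)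
  | oracle => exact Primrec.list_getElem?.comp Primrec.fst Primrec.snd
  | pair a b iha ihb =>
    refine Primrec.option_bind (iha.comp Primrec.fst Primrec.snd) ?_
    refine Primrec.option_map (ihb.comp (Primrec.fst.comp Primrec.fst)
      (Primrec.snd.comp Primrec.fst)) ?_
    exact Primrec₂.natPair.comp (Primrec.snd.comp Primrec.fst) Primrec.snd
  | comp a b iha ihb =>
    exact Primrec.option_bind (ihb.comp Primrec.fst Primrec.snd)
      (iha.comp (Primrec.fst.comp Primrec.fst) Primrec.snd)
  | prec a b iha ihb =>
    refine Primrec.nat_rec' (h := fun (q : List ℕ × ℕ) (s : ℕ × Option ℕ) => s.2.bind fun i =>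
      evalFin q.1 b (Nat.pair q.2.unpair.1 (Nat.pair s.1 i))) (u2.comp Primrec.snd) (iha.comp Primrec.fst (u1.comp Primrec.snd)) ?_
    refine Primrec.option_bind (Primrec.snd.comp Primrec.snd) ?_
    refine ihb.comp (Primrec.fst.comp (Primrec.fst.comp Primrec.fst)) ?_
    refine Primrec₂.natPair.comp (u1.comp (Primrec.snd.comp (Primrec.fst.comp Primrec.fst))) ?_
    exact Primrec₂.natPair.comp (Primrec.fst.comp (Primrec.snd.comp Primrec.fst)) Primrec.snd
  | rfind a iha =>
    refine Primrec.option_bind (f := fun q : List ℕ × ℕ =>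
      search (fun n => evalFin q.1 a (Nat.pair q.2 n)) q.1.length) ?_ ?_
    · refine Primrec.nat_rec' (h := fun (q : List ℕ × ℕ) (s : ℕ × Option ℕ) =>
        s.2.bind (searchStep (fun n => evalFin q.1 a (Nat.pair q.2 n)) s.1))
        (Primrec.list_length.comp Primrec.fst) (Primrec.const _) ?_
      refine Primrec.option_bind (Primrec.snd.comp Primrec.snd) ?_
      refine Primrec.ite (Primrec.eq.comp Primrec.snd (.const 0)) ?_
        (Primrec.option_some.comp Primrec.snd)
      have hn : Primrec fun q : ((List ℕ × ℕ) × ℕ × Option ℕ) × ℕ => q.1.2.1 :=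
        Primrec.fst.comp (Primrec.snd.comp Primrec.fst)
      refine Primrec.option_map (iha.comp (Primrec.fst.comp (Primrec.fst.comp Primrec.fst))
        (Primrec₂.natPair.comp (Primrec.snd.comp (Primrec.fst.comp Primrec.fst)) hn)) ?_
      exact Primrec.ite (Primrec.eq.comp Primrec.snd (.const 0))
        (Primrec.succ.comp (hn.comp Primrec.fst)) (.const 0)
    · exact Primrec.ite (Primrec.eq.comp Primrec.snd (.const 0)) (.const none)
        (Primrec.option_some.comp (Primrec.pred.comp Primrec.snd))

theorem search_succ (f : ℕ → Option ℕ) (n : ℕ) :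
    search f (n + 1) = (search f n).bind (searchStep f n) := rfl

theorem search_spec {f : ℕ → Option ℕ} {n st : ℕ} (h : search f n = some st) :
    (st = 0 ∧ ∀ m < n, ∃ v, f m = some v ∧ v ≠ 0) ∨
      ∃ k, st = k + 1 ∧ f k = some 0 ∧ ∀ m < k, ∃ v, f m = some v ∧ v ≠ 0 := by
  induction n generalizing st with
  | zero =>
    left
    simpa [search, eq_comm] using h
  | succ n ih =>
    rw [search_succ, Option.bind_eq_some_iff] at h
    obtain ⟨s, hs, hst⟩ := h
    rcases ih hs with ⟨rfl, hall⟩ | ⟨k, rfl, hk⟩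
    · simp only [searchStep, if_true, Option.map_eq_some_iff] at hst
      obtain ⟨v, hv, rfl⟩ := hst
      by_cases hv0 : v = 0
      · right
        subst hv0
        exact ⟨n, by simp, hv, hall⟩
      · left
        refine ⟨by simp [hv0], fun m hm => ?_⟩
        rcases Nat.lt_succ_iff_lt_or_eq.1 hm with hm | rfl
        · exact hall m hm
        · exact ⟨v, hv, hv0⟩
    · right
      refine ⟨k, ?_, hk⟩
      simpa [searchStep, eq_comm] using hst

theorem search_eq_zero {f : ℕ → Option ℕ} {n : ℕ} (h : ∀ m < n, ∃ v, f m = some v ∧ v ≠ 0) :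
    search f n = some 0 := by
  induction n with
  | zero => rfl
  | succ n ih =>
    obtain ⟨v, hv, hv0⟩ := h n n.lt_succ_self
    rw [search_succ, ih fun m hm => h m (hm.trans n.lt_succ_self)]
    simp [searchStep, hv, hv0]

theorem search_eq_succ {f : ℕ → Option ℕ} {k n : ℕ} (hkn : k < n) (hk : f k = some 0)
    (h : ∀ m < k, ∃ v, f m = some v ∧ v ≠ 0) : search f n = some (k + 1) := by
  induction n, hkn using Nat.le_induction with
  | base =>
    rw [search_succ, search_eq_zero h]
    simp [searchStep, hk]
  | succ n hn ih =>
    rw [search_succ, ih]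
    simp [searchStep]

theorem mem_eval_rfind {g : ℕ → Part ℕ} {a : OracleCode} {x k : ℕ} :
    k ∈ eval g (rfind a) x ↔ 0 ∈ eval g a (Nat.pair x k) ∧
      ∀ m < k, ∃ v ∈ eval g a (Nat.pair x m), v ≠ 0 := by
  refine (Nat.mem_rfind (p := fun n => (fun m => decide (m = 0)) <$>
    eval g a (Nat.pair x n))).trans ?_
  simp

theorem mem_eval_of_evalFin {g : Baire} {σ : List ℕ} (hσ : ∀ i v, σ[i]? = some v → g i = v)
    {c : OracleCode} {n v : ℕ} (h : evalFin σ c n = some v) :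
    v ∈ eval (fun k => Part.some (g k)) c n := by
  induction c generalizing n v with
  | zero | succ | left | right => simpa [evalFin, eval, eq_comm] using h
  | oracle => simp [eval, hσ n v h]
  | pair a b iha ihb =>
    simp only [evalFin, Option.bind_eq_some_iff, Option.map_eq_some_iff] at h
    obtain ⟨u, hu, w, hw, rfl⟩ := h
    simp only [eval, Seq.seq, Part.map_eq_map, Part.mem_bind_iff, Part.mem_map_iff]
    exact ⟨_, ⟨u, iha hu, rfl⟩, w, ihb hw, rfl⟩
  | comp a b iha ihb =>
    simp only [evalFin, Option.bind_eq_some_iff] at h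
    obtain ⟨u, hu, hv⟩ := h
    exact Part.mem_bind (ihb hu) (iha hv)
  | prec a b iha ihb =>
    simp only [evalFin] at h
    simp only [eval]
    generalize n.unpair.2 = m at h ⊢
    induction m generalizing v with
    | zero => exact iha h
    | succ m ih =>
      obtain ⟨u, hu, hv⟩ := Option.bind_eq_some_iff.1 h
      exact Part.mem_bind (ih hu) (ihb hv)
  | rfind a iha =>
    simp only [evalFin, Option.bind_eq_some_iff] at h
    obtain ⟨st, hst, hv⟩ := h
    rcases search_spec hst with ⟨rfl, -⟩ | ⟨k, rfl, hk, hlt⟩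
    · simp at hv
    · simp only [Nat.add_eq_zero_iff, one_ne_zero, and_false, if_false, Nat.add_sub_cancel,
        Option.some.injEq] at hv
      subst hv
      refine mem_eval_rfind.2 ⟨iha hk, fun m hm => ?_⟩
      obtain ⟨w, hw, hw0⟩ := hlt m hm
      exact ⟨w, iha hw, hw0⟩

/-- The first `l` values of `g`. -/
def init (g : Baire) (l : ℕ) : List ℕ := (List.range l).map g

/-- A halting computation consults only finitely many oracle values and makes finitely many search
steps, so every long enough beginning of the oracle gives the result. -/
theorem exists_evalFin_of_mem {g : Baire} {c : OracleCode} {n v : ℕ}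
    (h : v ∈ eval (fun k => Part.some (g k)) c n) :
    ∃ k, ∀ l, k ≤ l → evalFin (init g l) c n = some v := by
  induction c generalizing n v with
  | zero | succ | left | right => exact ⟨0, fun l _ => by simpa [evalFin, eval, eq_comm] using h⟩
  | oracle =>
    refine ⟨n + 1, fun l hl => ?_⟩
    have hn : n < l := hl
    simp only [eval, Part.mem_some_iff] at h
    simp [evalFin, init, hn, h]
  | pair a b iha ihb =>
    simp only [eval, Seq.seq, Part.map_eq_map, Part.mem_bind_iff, Part.mem_map_iff] at h
    obtain ⟨_, ⟨u, hu, rfl⟩, w, hw, rfl⟩ := h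
    obtain ⟨k₁, h₁⟩ := iha hu
    obtain ⟨k₂, h₂⟩ := ihb hw
    refine ⟨max k₁ k₂, fun l hl => ?_⟩
    simp [evalFin, h₁ l (le_of_max_le_left hl), h₂ l (le_of_max_le_right hl)]
  | comp a b iha ihb =>
    obtain ⟨u, hu, hv⟩ := Part.mem_bind_iff.1 h
    obtain ⟨k₁, h₁⟩ := ihb hu
    obtain ⟨k₂, h₂⟩ := iha hv
    refine ⟨max k₁ k₂, fun l hl => ?_⟩
    simp [evalFin, h₁ l (le_of_max_le_left hl), h₂ l (le_of_max_le_right hl)]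
  | prec a b iha ihb =>
    simp only [evalFin]
    simp only [eval] at h
    generalize n.unpair.2 = m at h ⊢
    induction m generalizing v with
    | zero => exact iha h
    | succ m ih =>
      obtain ⟨u, hu, hv⟩ := Part.mem_bind_iff.1 h
      obtain ⟨k₁, h₁⟩ := ih hu
      obtain ⟨k₂, h₂⟩ := ihb hv
      refine ⟨max k₁ k₂, fun l hl => ?_⟩
      exact Option.bind_eq_some_iff.2
        ⟨u, h₁ l (le_of_max_le_left hl), h₂ l (le_of_max_le_right hl)⟩
  | rfind a iha =>
    obtain ⟨hv, hlt⟩ := mem_eval_rfind.1 h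
    obtain ⟨k₀, hk₀⟩ := iha hv
    choose! w hw hw0 using hlt
    have hK : ∀ m, ∃ k, m < v → ∀ l, k ≤ l →
        evalFin (init g l) a (Nat.pair n m) = some (w m) := by
      intro m
      by_cases hm : m < v
      · obtain ⟨k, hk⟩ := iha (hw m hm)
        exact ⟨k, fun _ => hk⟩
      · exact ⟨0, fun h => absurd h hm⟩
    choose K hK using hK
    refine ⟨max (max k₀ (v + 1)) ((Finset.range v).sup K), fun l hl => ?_⟩
    have hl₁ : k₀ ≤ l := (le_max_left _ _).trans ((le_max_left _ _).trans hl)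
    have hl₂ : v < l := (le_max_right _ _).trans ((le_max_left _ _).trans hl)
    have hs : search (fun i => evalFin (init g l) a (Nat.pair n i)) l = some (v + 1) :=
      search_eq_succ hl₂ (hk₀ l hl₁) fun m hm => ⟨w m, hK m hm l
        ((Finset.le_sup (Finset.mem_range.2 hm)).trans ((le_max_right _ _).trans hl)), hw0 m hm⟩
    simp only [evalFin]
    have hlen : (init g l).length = l := by simp [init]
    rw [hlen, hs]
    simp

theorem exists_of_primrec {f : ℕ → ℕ} (hf : Primrec f) :
    ∃ c : OracleCode, ∀ g, c.eval g = fun k => Part.some (f k) :=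
  exists_of_partrec (Nat.Partrec.of_primrec (Primrec.nat_iff.1 hf))

theorem exists_initCode : ∃ c : OracleCode, ∀ (g : Baire) (l : ℕ),
    c.eval (fun k => Part.some (g k)) l = Part.some (Encodable.encode (init g l)) := by
  have u1 : Primrec (fun n : ℕ => n.unpair.1) := Primrec.fst.comp Primrec.unpair
  have u2 : Primrec (fun n : ℕ => n.unpair.2) := Primrec.snd.comp Primrec.unpair
  obtain ⟨nilc, hnil⟩ := exists_of_primrec (Primrec.const (Encodable.encode ([] : List ℕ)))
  obtain ⟨app, happ⟩ := exists_of_primrec (f := fun k : ℕ => Encodable.encode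
    (Denumerable.ofNat (List ℕ) k.unpair.1 ++ [k.unpair.2]))
    (Primrec.encode.comp (Primrec.list_append.comp ((Primrec.ofNat _).comp u1)
      (Primrec.list_cons.comp u2 (.const []))))
  obtain ⟨start, hstart⟩ := exists_of_primrec (f := fun l : ℕ => Nat.pair 0 l)
    (Primrec₂.natPair.comp (.const 0) .id)
  refine ⟨.comp (.prec nilc (.comp app (.pair (.comp .right .right)
    (.comp .oracle (.comp .left .right))))) start, fun g l => ?_⟩
  simp only [eval, hstart, Part.bind_eq_bind, Part.bind_some, Nat.unpair_pair]
  induction l with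
  | zero => simp [hnil, init]
  | succ l ih =>
    simp only [ih]
    simp [Seq.seq, happ, init, List.range_succ]

end OracleCode

/-! ### Forcing by finite extensions and cone avoidance -/

namespace Baire

open OracleCode

/-- The beginning of `p ⊕ q`, from beginnings of `p` and `q`. -/
def joinList (s t : List ℕ) : List ℕ :=
  (List.range (2 * min s.length t.length)).map fun i =>
    if i % 2 = 0 then s.getD (i / 2) 0 else t.getD (i / 2) 0

theorem primrec_joinList : Primrec₂ joinList := by
  refine Primrec.list_map (Primrec.list_range.comp (Primrec.nat_mul.comp (.const 2)
    (Primrec.nat_min.comp (Primrec.list_length.comp Primrec.fst)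
      (Primrec.list_length.comp Primrec.snd)))) ?_
  have half : Primrec fun q : (List ℕ × List ℕ) × ℕ => q.2 / 2 :=
    Primrec.nat_div.comp Primrec.snd (.const 2)
  exact Primrec.ite (Primrec.eq.comp (Primrec.nat_mod.comp Primrec.snd (.const 2)) (.const 0))
    ((Primrec.list_getD 0).comp (Primrec.fst.comp Primrec.fst) half)
    ((Primrec.list_getD 0).comp (Primrec.snd.comp Primrec.fst) half)

theorem joinList_spec {p q : Baire} {s t : List ℕ} (hs : ∀ i v, s[i]? = some v → p i = v)
    (ht : ∀ i v, t[i]? = some v → q i = v) {i v : ℕ} (h : (joinList s t)[i]? = some v) :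
    join p q i = v := by
  simp only [joinList, List.getElem?_map, Option.map_eq_some_iff] at h
  obtain ⟨j, hj, rfl⟩ := h
  obtain ⟨hi, rfl⟩ := List.getElem?_eq_some_iff.1 hj
  simp only [List.length_range] at hi
  have h1 : i / 2 < s.length := by omega
  have h2 : i / 2 < t.length := by omega
  simp [join, hs _ _ (List.getElem?_eq_getElem h1), ht _ _ (List.getElem?_eq_getElem h2), h1, h2]

theorem init_spec (p : Baire) (l : ℕ) (i v : ℕ) (h : (init p l)[i]? = some v) : p i = v := by
  simp only [init, List.getElem?_map, Option.map_eq_some_iff] at h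
  obtain ⟨j, hj, rfl⟩ := h
  obtain ⟨_, rfl⟩ := List.getElem?_eq_some_iff.1 hj
  simp

theorem joinList_init (p q : Baire) (l : ℕ) :
    joinList (init p l) (init q l) = init (join p q) (2 * l) := by
  simp only [joinList, init, List.length_map, List.length_range, min_self]
  refine List.map_congr_left fun i hi => ?_
  have h : i / 2 < l := by
    have := List.mem_range.1 hi
    omega
  simp [join, h]

/-- A function that is computed from `x` together with extensions of every finite extension of
`s` is computable from `x`. -/
theorem turingLE_of_forall_extension {p x : Baire} {c : OracleCode} (s : List ℕ)
    (H : ∀ t : List ℕ, ∃ y : Baire, (∀ i v, (s ++ t)[i]? = some v → y i = v) ∧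
      Computes c (join x y) p) : TuringLE p x := by
  obtain ⟨ini, hini⟩ := exists_initCode
  have u1 : Primrec (fun n : ℕ => n.unpair.1) := Primrec.fst.comp Primrec.unpair
  have u2 : Primrec (fun n : ℕ => n.unpair.2) := Primrec.snd.comp Primrec.unpair
  let F : ℕ → List ℕ → List ℕ → Option ℕ := fun n t ξ => evalFin (joinList ξ (s ++ t)) c n
  -- The input codes `⟨⟨n, ⟨t, l⟩⟩, ξ⟩`, where `ξ` will be the beginning of `x` of length `l`.
  let G : ℕ → Option ℕ := fun k => F k.unpair.1.unpair.1
    (Denumerable.ofNat (List ℕ) k.unpair.1.unpair.2.unpair.1)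
    (Denumerable.ofNat (List ℕ) k.unpair.2)
  have hG : Primrec G := (primrec_evalFin c).comp
    (primrec_joinList.comp ((Primrec.ofNat _).comp u2) (Primrec.list_append.comp (.const s)
      ((Primrec.ofNat _).comp (u1.comp (u2.comp u1)))))
    (u1.comp u1)
  obtain ⟨test, htest⟩ := exists_of_primrec (f := fun k => if G k = none then 1 else 0)
    (Primrec.ite (Primrec.eq.comp hG (.const none)) (.const 1) (.const 0))
  obtain ⟨val, hval⟩ := exists_of_primrec (f := fun k => (G k).getD 0)
    (Primrec.option_getD.comp hG (.const 0))
  obtain ⟨idc, hid⟩ := exists_of_primrec Primrec.id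
  let data : OracleCode := .pair idc (.comp ini (.comp .right .right))
  have hdata : ∀ n m, data.eval (fun k => Part.some (x k)) (Nat.pair n m) =
      Part.some (Nat.pair (Nat.pair n m) (Encodable.encode (init x m.unpair.2))) := by
    intro n m
    simp [data, eval, hid, hini, Seq.seq]
  let val' : ℕ → ℕ → Option ℕ := fun n m =>
    F n (Denumerable.ofNat (List ℕ) m.unpair.1) (init x m.unpair.2)
  -- Whatever extension `t` the search tries, some `y` extending `s ++ t` computes `p` correctly, so
  -- a halting computation from `t` cannot give a wrong value.
  have hsound : ∀ n m v, val' n m = some v → p n = v := by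
    intro n m v h
    obtain ⟨y, hy, hc⟩ := H (Denumerable.ofNat (List ℕ) m.unpair.1)
    have := mem_eval_of_evalFin (g := join x y)
      (fun i v => joinList_spec (init_spec x _) hy) h
    rw [show eval _ c = _ from hc] at this
    exact (Part.mem_some_iff.1 this).symm
  have hcomplete : ∀ n, ∃ m, val' n m ≠ none := by
    intro n
    obtain ⟨y, hy, hc⟩ := H []
    rw [List.append_nil] at hy
    obtain ⟨k, hk⟩ := exists_evalFin_of_mem (g := join x y) (c := c) (n := n) (v := p n)
      (by rw [show eval _ c = _ from hc]; exact Part.mem_some _)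
    -- Long enough for the computation to halt and for the beginning of `y` to contain `s`.
    let l := max k s.length
    have hpre : s ++ (init y l).drop s.length = init y l := by
      have : (init y l).take s.length = s := by
        refine List.ext_getElem ?_ fun i h1 h2 => ?_
        · simp [init, l]
        · have := hy i _ (List.getElem?_eq_getElem h2)
          simp [init, this]
      conv_lhs => rw [← this]
      simp [init, l]
    refine ⟨Nat.pair (Encodable.encode ((init y l).drop s.length)) l, ?_⟩
    simp only [val', F, Nat.unpair_pair, Denumerable.ofNat_encode, hpre, joinList_init]
    rw [hk _ (by simp only [l]; omega)]
    simp
  refine turingLE_iff.2 ⟨.comp (.comp val data) (.pair idc (.rfind (.comp test data))), ?_⟩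
  funext n
  have hmem : ∃ m, m ∈ eval (fun k => Part.some (x k)) (.rfind (.comp test data)) n ∧
      val' n m ≠ none := by
    classical
    refine ⟨Nat.find (hcomplete n), mem_eval_rfind.2 ⟨?_, fun m hm => ⟨1, ?_, one_ne_zero⟩⟩,
      Nat.find_spec (hcomplete n)⟩
    · have := Nat.find_spec (hcomplete n)
      simp only [val'] at this
      simp [eval, hdata, htest, G, this]
    · have := Nat.find_min (hcomplete n) hm
      simp only [val', not_not] at this
      simp [eval, hdata, htest, G, this]
  obtain ⟨m, hm, hne⟩ := hmem
  obtain ⟨v, hv⟩ := Option.ne_none_iff_exists'.1 hne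
  have hvp := hsound n m v hv
  simp only [val'] at hv
  have hr := Part.eq_some_iff.2 hm
  rw [eval, eval]
  beta_reduce
  rw [hid, hr]
  simp [Seq.seq, eval, hdata, hval, G, hv, hvp]

/-- Countably many requirements, each of which can be forced by extending any finite sequence,
are simultaneously satisfiable. -/
theorem exists_forall_mem_of_extension {ι : Type*} [Countable ι] (R : ι → Set Baire)
    (hR : ∀ i (y₀ : Baire) (n : ℕ), ∃ (y₁ : Baire) (m : ℕ), (∀ j < n, y₁ j = y₀ j) ∧
      ∀ y : Baire, (∀ j < m, y j = y₁ j) → y ∈ R i) : ∃ y, ∀ i, y ∈ R i := by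
  have hopen := PiNat.isTopologicalBasis_cylinders (fun _ : ℕ => ℕ)
  have hd : Dense (⋂ i, interior (R i)) := by
    refine dense_iInter_of_isOpen (fun i => isOpen_interior) fun i => ?_
    rw [hopen.dense_iff]
    rintro o ⟨y₀, n, rfl⟩ -
    obtain ⟨y₁, m, h₁, h₂⟩ := hR i y₀ n
    refine ⟨y₁, h₁, mem_interior.2 ⟨PiNat.cylinder y₁ m, h₂,
      PiNat.isOpen_cylinder _ y₁ m, PiNat.self_mem_cylinder y₁ m⟩⟩
  obtain ⟨y, hy⟩ := hd.nonempty
  exact ⟨y, fun i => interior_subset (Set.mem_iInter.1 hy i)⟩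

theorem countable_oracleCode : Countable OracleCode := ofIndex_surjective.countable

/-- Cone avoidance. -/
theorem exists_not_turingLE_join {p x : Baire} (hp : ¬ TuringLE p x) :
    ∃ y, ¬ TuringLE y x ∧ ¬ TuringLE p (join x y) := by
  have := countable_oracleCode
  suffices ∃ y, ∀ c, y ∈ {y | ¬ Computes c x y ∧ ¬ Computes c (join x y) p} by
    obtain ⟨y, hy⟩ := this
    refine ⟨y, fun h => ?_, fun h => ?_⟩ <;> obtain ⟨c, hc⟩ := turingLE_iff.1 h
    exacts [(hy c).1 hc, (hy c).2 hc]
  refine exists_forall_mem_of_extension _ ?_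
  intro c y₀ n
  obtain ⟨y₁, h₁, hy₁⟩ : ∃ y₁ : Baire, (∀ j < n, y₁ j = y₀ j) ∧
      ∀ y : Baire, (∀ j < n + 1, y j = y₁ j) → ¬ Computes c x y := by
    -- The program computes at most one `z` from `x`; the value `z n + 1` at place `n` rules it out.
    by_cases h : ∃ z, Computes c x z
    · obtain ⟨z, hz⟩ := h
      refine ⟨fun j => if j < n then y₀ j else z j + 1, fun j hj => by simp [hj],
        fun y hy hc => ?_⟩
      have := hy n n.lt_succ_self
      simp [hc.unique hz] at this
    · exact ⟨y₀, fun _ _ => rfl, fun y _ hc => h ⟨y, hc⟩⟩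
  -- If no extension prevented the computation of `p`, then `x` alone would compute `p`.
  obtain ⟨t, ht⟩ : ∃ t : List ℕ, ∀ y : Baire,
      (∀ i v, (init y₁ (n + 1) ++ t)[i]? = some v → y i = v) → ¬ Computes c (join x y) p := by
    by_contra! h
    exact hp (turingLE_of_forall_extension _ h)
  have hlen : (init y₁ (n + 1)).length = n + 1 := by simp [init]
  have hget : ∀ j < n + 1, (init y₁ (n + 1) ++ t).getD j 0 = y₁ j := by
    intro j hj
    rw [List.getD_append _ _ _ _ (by omega)]
    simp [init, hj]
  refine ⟨fun j => (init y₁ (n + 1) ++ t).getD j 0, n + 1 + t.length, fun j hj => ?_,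
    fun y hy => ⟨hy₁ y fun j hj => ?_, ht y fun i v hi => ?_⟩⟩
  · exact (hget j (by omega)).trans (h₁ j hj)
  · exact (hy j (by omega)).trans (hget j hj)
  · obtain ⟨hil, rfl⟩ := List.getElem?_eq_some_iff.1 hi
    rw [List.length_append, hlen] at hil
    rw [hy i hil]
    simp [List.getD_eq_getElem?_getD, hi]

end Baire

/-! ### Weihrauch reductions, coproducts and minimal covers -/

namespace Problem

open Baire

/-- The forward program `c` and the backward program `d` solve the instance `z`, with solution
set `S`, by means of `g`. -/
def Solves (c d : OracleCode) (g : Problem) (z : Baire) (S : Set Baire) : Prop :=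
  ∃ z', Computes c z z' ∧ z' ∈ g.dom ∧ ∀ q ∈ g z', ∃ r, Computes d (join z q) r ∧ r ∈ S

theorem le_iff {f g : Problem} : f ≤ g ↔ ∃ c d, ∀ z ∈ f.dom, Solves c d g z (f z) := by
  constructor
  · rintro ⟨c, d, h⟩
    refine ⟨.ofIndex c, .ofIndex d, fun z hz => ?_⟩
    obtain ⟨z', hz', hdom, H⟩ := h z hz
    refine ⟨z', mem_Φ.1 hz', hdom, fun q hq => ?_⟩
    obtain ⟨r, hr, hrS⟩ := H q hq
    exact ⟨r, mem_Φ.1 hr, hrS⟩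
  · rintro ⟨c, d, h⟩
    obtain ⟨c, rfl⟩ := OracleCode.ofIndex_surjective c
    obtain ⟨d, rfl⟩ := OracleCode.ofIndex_surjective d
    refine ⟨c, d, fun z hz => ?_⟩
    obtain ⟨z', hz', hdom, H⟩ := h z hz
    refine ⟨z', mem_Φ.2 hz', hdom, fun q hq => ?_⟩
    obtain ⟨r, hr, hrS⟩ := H q hq
    exact ⟨r, mem_Φ.2 hr, hrS⟩

/-- If the instance `z` can be computed from `w`, then solving `z` is enough to find a solution
that is computable from `w`, uniformly in `w`. -/
theorem exists_solves_of_computes (a c d : OracleCode) : ∃ c' d', ∀ (g : Problem) w z S,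
    Computes a w z → Solves c d g z S → Solves c' d' g w S := by
  obtain ⟨l, hl⟩ := exists_leftCode
  obtain ⟨r, hr⟩ := exists_rightCode
  obtain ⟨m, hm⟩ := exists_computes_join (l.subst a) r
  refine ⟨a.subst c, m.subst d, fun g w z S ha ⟨z', hz', hdom, H⟩ =>
    ⟨z', ha.subst hz', hdom, fun q hq => ?_⟩⟩
  obtain ⟨s, hs, hsS⟩ := H q hq
  exact ⟨s, (hm _ _ _ ((hl w q).subst ha) (hr w q)).subst hs, hsS⟩

theorem exists_solves_ite (n : ℕ) (c d c' d' : OracleCode) : ∃ c₁ d₁, ∀ (g : Problem) z S,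
    (z 0 = n → Solves c d g z S → Solves c₁ d₁ g z S) ∧
    (z 0 ≠ n → Solves c' d' g z S → Solves c₁ d₁ g z S) := by
  obtain ⟨c₁, hc₁⟩ := exists_iteCode n c c'
  obtain ⟨d₁, hd₁⟩ := exists_iteCode n d d'
  refine ⟨c₁, d₁, fun g z S => ⟨?_, ?_⟩⟩
  · rintro hn ⟨z', hz', hdom, H⟩
    refine ⟨z', (hc₁ _ _).1 hn hz', hdom, fun q hq => ?_⟩
    obtain ⟨s, hs, hsS⟩ := H q hq
    exact ⟨s, (hd₁ _ _).1 hn hs, hsS⟩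
  · rintro hn ⟨z', hz', hdom, H⟩
    refine ⟨z', (hc₁ _ _).2 hn hz', hdom, fun q hq => ?_⟩
    obtain ⟨s, hs, hsS⟩ := H q hq
    exact ⟨s, (hd₁ _ _).2 hn hs, hsS⟩

theorem le_of_subset {f g : Problem} (h₁ : f.dom ⊆ g.dom) (h₂ : ∀ z ∈ f.dom, g z ⊆ f z) :
    f ≤ g := by
  obtain ⟨r, hr⟩ := exists_rightCode
  exact le_iff.2 ⟨.oracle, r, fun z hz => ⟨z, computes_oracle z, h₁ hz, fun q hq =>
    ⟨q, hr z q, h₂ z hz hq⟩⟩⟩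

/-- The coproduct of two problems. -/
def coprod (f g : Problem) : Problem := fun z =>
  {r | (z 0 = 0 ∧ r ∈ f fun n => z (n + 1)) ∨ (z 0 = 1 ∧ r ∈ g fun n => z (n + 1))}

@[simp] theorem coprod_cons_zero (f g : Problem) (z : Baire) : coprod f g (cons 0 z) = f z := by
  ext r
  simp [coprod]

@[simp] theorem coprod_cons_one (f g : Problem) (z : Baire) : coprod f g (cons 1 z) = g z := by
  ext r
  simp [coprod]

theorem cons_zero_mem_dom {f g : Problem} {z : Baire} :
    cons 0 z ∈ (coprod f g).dom ↔ z ∈ f.dom := by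
  simp [dom]

theorem cons_one_mem_dom {f g : Problem} {z : Baire} :
    cons 1 z ∈ (coprod f g).dom ↔ z ∈ g.dom := by
  simp [dom]

theorem mem_dom_coprod {f g : Problem} {z : Baire} : z ∈ (coprod f g).dom ↔
    (∃ w ∈ f.dom, z = cons 0 w) ∨ ∃ w ∈ g.dom, z = cons 1 w := by
  constructor
  · rintro ⟨r, ⟨h0, hr⟩ | ⟨h1, hr⟩⟩
    · exact Or.inl ⟨_, ⟨r, hr⟩, h0 ▸ eq_cons z⟩
    · exact Or.inr ⟨_, ⟨r, hr⟩, h1 ▸ eq_cons z⟩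
  · rintro (⟨w, hw, rfl⟩ | ⟨w, hw, rfl⟩)
    · exact cons_zero_mem_dom.2 hw
    · exact cons_one_mem_dom.2 hw

theorem le_coprod_left (f g : Problem) : f ≤ coprod f g := by
  obtain ⟨r, hr⟩ := exists_rightCode
  obtain ⟨c, hc⟩ := exists_consCode 0
  refine le_iff.2 ⟨c, r, fun z hz => ⟨_, hc z, cons_zero_mem_dom.2 hz, fun q hq =>
    ⟨q, hr z q, by simpa using hq⟩⟩⟩

theorem le_coprod_right (f g : Problem) : g ≤ coprod f g := by
  obtain ⟨r, hr⟩ := exists_rightCode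
  obtain ⟨c, hc⟩ := exists_consCode 1
  refine le_iff.2 ⟨c, r, fun z hz => ⟨_, hc z, cons_one_mem_dom.2 hz, fun q hq =>
    ⟨q, hr z q, by simpa using hq⟩⟩⟩

theorem coprod_le {f g k : Problem} (hf : f ≤ k) (hg : g ≤ k) : coprod f g ≤ k := by
  obtain ⟨t, ht⟩ := exists_tailCode
  obtain ⟨c, d, hcd⟩ := le_iff.1 hf
  obtain ⟨c', d', hcd'⟩ := le_iff.1 hg
  obtain ⟨a, b, hab⟩ := exists_solves_of_computes t c d
  obtain ⟨a', b', hab'⟩ := exists_solves_of_computes t c' d'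
  obtain ⟨u, v, huv⟩ := exists_solves_ite 0 a b a' b'
  refine le_iff.2 ⟨u, v, fun z hz => ?_⟩
  rcases mem_dom_coprod.1 hz with ⟨w, hw, rfl⟩ | ⟨w, hw, rfl⟩
  · rw [coprod_cons_zero]
    exact (huv _ _ _).1 rfl (hab _ _ _ _ (ht 0 w) (hcd w hw))
  · rw [coprod_cons_one]
    exact (huv _ _ _).2 one_ne_zero (hab' _ _ _ _ (ht 1 w) (hcd' w hw))

/-- Otherwise `h ⊔ k` would lie strictly between `h` and `g`. This is the form in which minimality
of a cover is used. -/
theorem le_coprod_of_covBy {g h k : Problem} (hc : h ⋖ g) (hkg : k ≤ g) (hkh : ¬ k ≤ h) :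
    g ≤ coprod h k := by
  by_contra hg
  exact hc.2 ⟨le_coprod_left h k, fun h' => hkh ((le_coprod_right h k).trans h')⟩
    ⟨coprod_le hc.1.le hkg, hg⟩

/-! ### Countable families and single instances -/

/-- The problem with instances `⟨n⟩⌢X n`, whose solution sets are the `A n`. -/
def family (X : ℕ → Baire) (A : ℕ → Set Baire) : Problem := fun z =>
  {r | z = cons (z 0) (X (z 0)) ∧ r ∈ A (z 0)}

@[simp] theorem family_cons (X : ℕ → Baire) (A : ℕ → Set Baire) (n : ℕ) :
    family X A (cons n (X n)) = A n := by
  ext r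
  simp [family]

theorem mem_dom_family {X : ℕ → Baire} {A : ℕ → Set Baire} {z : Baire} :
    z ∈ (family X A).dom ↔ ∃ n, (A n).Nonempty ∧ z = cons n (X n) := by
  constructor
  · rintro ⟨r, hz, hr⟩
    exact ⟨z 0, ⟨r, hr⟩, hz⟩
  · rintro ⟨n, hn, rfl⟩
    simpa [dom] using hn

theorem family_le_iff {X : ℕ → Baire} {A : ℕ → Set Baire} {g : Problem} :
    family X A ≤ g ↔ ∃ c d, ∀ n, (A n).Nonempty → Solves c d g (cons n (X n)) (A n) := by
  rw [le_iff]
  refine exists_congr fun c => exists_congr fun d => ⟨fun h n hn => ?_, fun h z hz => ?_⟩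
  · simpa using h _ (mem_dom_family.2 ⟨n, hn, rfl⟩)
  · obtain ⟨n, hn, rfl⟩ := mem_dom_family.1 hz
    simpa using h n hn

/-- The problem with the single instance `x`. -/
def single (x : Baire) (A : Set Baire) : Problem := fun z => {r | z = x ∧ r ∈ A}

theorem single_self (x : Baire) (A : Set Baire) : single x A x = A := by
  ext r
  simp [single]

theorem single_le_iff {x : Baire} {A : Set Baire} (hA : A.Nonempty) {g : Problem} :
    single x A ≤ g ↔ ∃ c d, Solves c d g x A := by
  rw [le_iff]
  refine exists_congr fun c => exists_congr fun d => ⟨fun h => ?_, fun h z hz => ?_⟩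
  · have := h x
    rw [single_self] at this
    exact this (by simpa [dom, single_self] using hA)
  · obtain ⟨r, rfl, hr⟩ := hz
    rwa [single_self]

/-- The problem with the single instance `x`, all of whose answers are correct. -/
abbrev point (x : Baire) : Problem := single x Set.univ

theorem mem_dom_point {x z : Baire} : z ∈ (point x).dom ↔ z = x := by
  constructor
  · rintro ⟨r, h, -⟩
    exact h
  · rintro rfl
    exact ⟨z, rfl, trivial⟩

theorem point_le_iff {x : Baire} {g : Problem} : point x ≤ g ↔ ∃ z ∈ g.dom, TuringLE z x := by
  rw [single_le_iff Set.univ_nonempty]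
  constructor
  · rintro ⟨c, d, z, hz, hdom, -⟩
    exact ⟨z, hdom, hz.turingLE⟩
  · rintro ⟨z, hdom, hz⟩
    obtain ⟨c, hc⟩ := turingLE_iff.1 hz
    exact ⟨c, .oracle, z, hc, hdom, fun q _ => ⟨_, computes_oracle _, trivial⟩⟩

theorem point_le_single {x : Baire} {A : Set Baire} (hA : A.Nonempty) : point x ≤ single x A :=
  point_le_iff.2 ⟨x, by simpa [dom, single_self] using hA, turingLE_iff.2 ⟨_, computes_oracle x⟩⟩

theorem single_le_of_turingLE {x r : Baire} {A : Set Baire} {g : Problem} (hr : r ∈ A)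
    (hrx : TuringLE r x) (hx : point x ≤ g) : single x A ≤ g := by
  obtain ⟨z, hdom, hz⟩ := point_le_iff.1 hx
  obtain ⟨c, hc⟩ := turingLE_iff.1 hz
  obtain ⟨d, hd⟩ := turingLE_iff.1 hrx
  obtain ⟨l, hl⟩ := exists_leftCode
  exact (single_le_iff ⟨r, hr⟩).2 ⟨c, l.subst d, z, hc, hdom, fun q _ =>
    ⟨r, (hl x q).subst hd, hr⟩⟩

theorem family_const_le_single {x : Baire} {A : Set Baire} {B : ℕ → Set Baire}
    (hA : A.Nonempty) (hB : ∀ n, A ⊆ B n) : family (fun _ => x) B ≤ single x A := by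
  obtain ⟨t, ht⟩ := exists_tailCode
  obtain ⟨r, hr⟩ := exists_rightCode
  refine family_le_iff.2 ⟨t, r, fun n _ => ⟨x, ht n x, ?_, fun q hq => ⟨q, hr _ _, hB n ?_⟩⟩⟩
  · simpa [dom, single_self] using hA
  · simpa [single_self] using hq

theorem family_le {X : ℕ → Baire} {g : Problem} : family X (fun n => g (X n)) ≤ g := by
  obtain ⟨t, ht⟩ := exists_tailCode
  obtain ⟨r, hr⟩ := exists_rightCode
  exact family_le_iff.2 ⟨t, r, fun n hn => ⟨X n, ht n _, hn, fun q hq => ⟨q, hr _ _, hq⟩⟩⟩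

/-- An enumeration of all pairs of a forward and a backward program. -/
def codes (n : ℕ) : OracleCode × OracleCode :=
  (.ofIndex n.unpair.1, .ofIndex n.unpair.2)

theorem codes_surjective : Function.Surjective codes := by
  rintro ⟨c, d⟩
  obtain ⟨i, rfl⟩ := OracleCode.ofIndex_surjective c
  obtain ⟨j, rfl⟩ := OracleCode.ofIndex_surjective d
  exact ⟨Nat.pair i j, by simp [codes]⟩

theorem not_family_le {X : ℕ → Baire} {A : ℕ → Set Baire} {g : Problem}
    (hA : ∀ n, (A n).Nonempty)
    (h : ∀ n, ¬ Solves (codes n).1 (codes n).2 g (cons n (X n)) (A n)) : ¬ family X A ≤ g := by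
  intro hle
  obtain ⟨c, d, hcd⟩ := family_le_iff.1 hle
  obtain ⟨n, hn⟩ := codes_surjective (c, d)
  apply h n
  rw [hn]
  exact hcd n (hA n)

/-- Irreducibility is witnessed by a countable family of instances. -/
theorem exists_family_not_le {g h : Problem} (hgh : ¬ g ≤ h) :
    ∃ X : ℕ → Baire, (∀ n, (g (X n)).Nonempty) ∧ ¬ family X (fun n => g (X n)) ≤ h := by
  -- Otherwise the `n`-th pair of programs, run after prefixing `n`, would reduce `g` to `h`.
  have key : ∀ n, ∃ x, (g x).Nonempty ∧
      ¬ Solves (codes n).1 (codes n).2 h (cons n x) (g x) := by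
    intro n
    obtain ⟨a, ha⟩ := exists_consCode n
    obtain ⟨c, d, hcd⟩ := exists_solves_of_computes a (codes n).1 (codes n).2
    by_contra! hx
    exact hgh (le_iff.2 ⟨c, d, fun z hz => hcd _ _ _ _ (ha z) (hx z hz)⟩)
  choose X hX hS using key
  exact ⟨X, hX, not_family_le hX hS⟩

/-! ### Splitting a family whose members reduce to `h` singly -/

/-- All instances of a family with index in `I` are solved by a single reduction to `h`. -/
def UniformlySolves (h : Problem) (X : ℕ → Baire) (A : ℕ → Set Baire) (I : Set ℕ) : Prop :=
  ∃ c d, ∀ n ∈ I, Solves c d h (cons n (X n)) (A n)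

/-- Finitely many further instances can be hard-coded, since the index is the first entry of the
instance. -/
theorem UniformlySolves.union_Iio {h : Problem} {X : ℕ → Baire} {A : ℕ → Set Baire} {I : Set ℕ}
    (hI : UniformlySolves h X A I) (hA : ∀ n, ∃ c d, Solves c d h (cons n (X n)) (A n)) (N : ℕ) :
    UniformlySolves h X A (I ∪ Set.Iio N) := by
  induction N with
  | zero =>
    obtain ⟨c, d, hcd⟩ := hI
    exact ⟨c, d, fun n hn => hcd n (by simpa using hn)⟩
  | succ N ih =>
    obtain ⟨c, d, hcd⟩ := ih
    obtain ⟨c', d', hcd'⟩ := hA N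
    obtain ⟨a, b, hab⟩ := exists_solves_ite N c' d' c d
    refine ⟨a, b, fun n hn => ?_⟩
    by_cases hnN : n = N
    · subst hnN
      exact (hab _ _ _).1 rfl hcd'
    · refine (hab _ _ _).2 hnN (hcd n ?_)
      rcases hn with hn | hn
      · exact Or.inl hn
      · exact Or.inr (lt_of_le_of_ne (Nat.lt_succ_iff.1 hn) hnN)

/-- The subfamily of all instances with index `n` such that `y n = 0`. -/
def subfamily (X : ℕ → Baire) (A : ℕ → Set Baire) (y : Baire) : Problem :=
  family X fun n => {r | r ∈ A n ∧ y n = 0}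

theorem mem_dom_subfamily {X : ℕ → Baire} {A : ℕ → Set Baire} {y z : Baire} :
    z ∈ (subfamily X A y).dom ↔ ∃ n, (A n).Nonempty ∧ y n = 0 ∧ z = cons n (X n) := by
  rw [subfamily, mem_dom_family]
  refine exists_congr fun n => ?_
  constructor
  · rintro ⟨⟨r, hr, hy⟩, hz⟩
    exact ⟨⟨r, hr⟩, hy, hz⟩
  · rintro ⟨⟨r, hr⟩, hy, hz⟩
    exact ⟨⟨r, hr, hy⟩, hz⟩

theorem subfamily_cons {X : ℕ → Baire} {A : ℕ → Set Baire} {y : Baire} {n : ℕ} (hn : y n = 0) :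
    subfamily X A y (cons n (X n)) = A n := by
  simp [subfamily, hn]

theorem subfamily_le (X : ℕ → Baire) (A : ℕ → Set Baire) (y : Baire) :
    subfamily X A y ≤ family X A := by
  refine le_of_subset (fun z hz => ?_) fun z hz => ?_ <;>
    obtain ⟨n, hA, hn, rfl⟩ := mem_dom_subfamily.1 hz
  · exact mem_dom_family.2 ⟨n, hA, rfl⟩
  · rw [subfamily_cons hn, family_cons]

/-- The forward program produces a single instance, so at most one value of `y` matters. -/
theorem Solves.congr_subfamily {c d : OracleCode} {h : Problem} {X : ℕ → Baire}
    {A : ℕ → Set Baire} {y y' z : Baire} {S : Set Baire}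
    (hs : Solves c d (coprod h (subfamily X A y)) z S)
    (hy : ∀ j, Computes c z (cons 1 (cons j (X j))) → y j = y' j) :
    Solves c d (coprod h (subfamily X A y')) z S := by
  obtain ⟨z', hz', hdom, H⟩ := hs
  rcases mem_dom_coprod.1 hdom with ⟨w, hw, rfl⟩ | ⟨w, hw, rfl⟩
  · refine ⟨_, hz', cons_zero_mem_dom.2 hw, ?_⟩
    simpa using H
  · obtain ⟨j, hA, hj, rfl⟩ := mem_dom_subfamily.1 hw
    have hj' : y' j = 0 := (hy j hz').symm.trans hj
    refine ⟨_, hz', cons_one_mem_dom.2 (mem_dom_subfamily.2 ⟨j, hA, hj', rfl⟩), ?_⟩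
    rw [coprod_cons_one, subfamily_cons hj] at H
    rwa [coprod_cons_one, subfamily_cons hj']

/-- If each instance of a family reduces to `h` but the family does not, then it splits
properly: some subfamily is not reducible to `h` and does not help to reduce the family. -/
theorem exists_subfamily {h : Problem} {X : ℕ → Baire} {A : ℕ → Set Baire}
    (hne : ∀ n, (A n).Nonempty) (hle : ¬ family X A ≤ h)
    (hA : ∀ n, single (cons n (X n)) (A n) ≤ h) :
    ∃ y, ¬ subfamily X A y ≤ h ∧ ¬ family X A ≤ coprod h (subfamily X A y) := by
  have hA' : ∀ n, ∃ c d, Solves c d h (cons n (X n)) (A n) := fun n =>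
    (single_le_iff (hne n)).1 (hA n)
  have hfin : ∀ N, UniformlySolves h X A (Set.Iio N) := fun N => by
    have : UniformlySolves h X A ∅ := ⟨.zero, .zero, fun n hn => absurd hn (Set.notMem_empty n)⟩
    simpa using this.union_Iio hA' N
  have hcof : ∀ N, ¬ UniformlySolves h X A (Set.Ici N) := fun N hN => by
    obtain ⟨c, d, hcd⟩ := hN.union_Iio hA' N
    exact hle (family_le_iff.2 ⟨c, d, fun n _ => hcd n (by
      rw [Set.union_comm, Set.Iio_union_Ici]; trivial)⟩)
  have := countable_oracleCode
  suffices ∃ y, ∀ i : OracleCode × OracleCode, y ∈ {y |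
      (∃ n, y n = 0 ∧ ¬ Solves i.1 i.2 h (cons n (X n)) (A n)) ∧
      ∃ n, ¬ Solves i.1 i.2 (coprod h (subfamily X A y)) (cons n (X n)) (A n)} by
    obtain ⟨y, hy⟩ := this
    refine ⟨y, fun hle => ?_, fun hle => ?_⟩ <;> obtain ⟨c, d, hcd⟩ := family_le_iff.1 hle
    · obtain ⟨n, hn, hs⟩ := (hy (c, d)).1
      obtain ⟨r, hr⟩ := hne n
      have := hcd n ⟨r, hr, hn⟩
      simp only [hn, and_true, Set.ofPred_mem_eq] at this
      exact hs this
    · obtain ⟨n, hs⟩ := (hy (c, d)).2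
      exact hs (hcd n (hne n))
  refine exists_forall_mem_of_extension _ ?_
  rintro ⟨c, d⟩ y₀ N
  obtain ⟨n, hNn, hn⟩ : ∃ n, N ≤ n ∧ ¬ Solves c d h (cons n (X n)) (A n) := by
    by_contra! hs
    exact hcof N ⟨c, d, hs⟩
  -- Beyond `N` only `n` is selected, so the subfamily is finite and hence reduces to `h`. The
  -- coproduct with it is then no stronger than `h`, and the pair `(c, d)` fails at some `m`.
  let y₁ : Baire := fun j => if j < N then y₀ j else if j = n then 0 else 1
  have hy₁ : ∀ j, y₁ j = 0 → j < n + 1 := by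
    intro j hj
    by_contra hjn
    simp [y₁, show ¬ j < N by omega, show ¬ j = n by omega] at hj
  have hsub : subfamily X A y₁ ≤ h := by
    obtain ⟨a, b, hab⟩ := hfin (n + 1)
    refine le_iff.2 ⟨a, b, fun z hz => ?_⟩
    obtain ⟨j, -, hj, rfl⟩ := mem_dom_subfamily.1 hz
    rw [subfamily_cons hj]
    exact hab j (hy₁ j hj)
  obtain ⟨m, hm⟩ : ∃ m, ¬ Solves c d (coprod h (subfamily X A y₁)) (cons m (X m)) (A m) := by
    by_contra! hs
    exact hle ((family_le_iff.2 ⟨c, d, fun m _ => hs m⟩).trans (coprod_le le_rfl hsub))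
  -- Fixing `y` below `M` preserves the failure at `m`, whatever is selected later.
  obtain ⟨M, hM⟩ : ∃ M, ∀ j, Computes c (cons m (X m)) (cons 1 (cons j (X j))) → j < M := by
    by_cases hj : ∃ j, Computes c (cons m (X m)) (cons 1 (cons j (X j)))
    · obtain ⟨j, hj⟩ := hj
      refine ⟨j + 1, fun i hi => ?_⟩
      have := (cons_inj.1 (cons_inj.1 (hi.unique hj)).2).1
      omega
    · exact ⟨0, fun j hj' => absurd ⟨j, hj'⟩ hj⟩
  refine ⟨y₁, max (n + 1) M, fun j hj => by simp [y₁, hj], fun y hy => ⟨⟨n, ?_, hn⟩, m, fun hs =>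
    hm (hs.congr_subfamily fun j hj => hy j ((hM j hj).trans_le (le_max_right _ _)))⟩⟩
  rw [hy n (by omega)]
  simp [y₁, show ¬ n < N by omega]

/-- Otherwise `exists_subfamily` gives a subfamily below `g`, not below `h`, whose join with `h` is
not above `g`. -/
theorem exists_single_of_covBy {g h : Problem} (hc : h ⋖ g) :
    ∃ x A, A.Nonempty ∧ single x A ≤ g ∧ ¬ single x A ≤ h := by
  obtain ⟨X, hne, hX⟩ := exists_family_not_le hc.1.not_ge
  by_contra! hs
  have hle : ∀ n, single (cons n (X n)) (g (X n)) ≤ g := by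
    intro n
    obtain ⟨c, d, hcd⟩ := family_le_iff.1 (family_le (X := X) (g := g))
    exact (single_le_iff (hne n)).2 ⟨c, d, hcd n (hne n)⟩
  obtain ⟨y, hy, hy'⟩ := exists_subfamily hne hX fun n => hs _ _ (hne n) (hle n)
  exact hy' (family_le.trans (le_coprod_of_covBy hc ((subfamily_le _ _ y).trans family_le) hy))

/-- A problem with a single instance that computes an instance of `h` is not the top of a
minimal cover of `h`. -/
theorem exists_between_of_point_le {h : Problem} {x : Baire} {A : Set Baire} (hA : A.Nonempty)
    (hx : point x ≤ h) (hxA : ¬ single x A ≤ h) :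
    ∃ k, k ≤ single x A ∧ ¬ k ≤ h ∧ ¬ single x A ≤ coprod h k := by
  have key : ∀ n, ∃ v : ℕ, ¬ Solves (codes n).1 (codes n).2 h (cons n x) (A ∪ {fun _ => v}) := by
    intro n
    by_contra! hv
    obtain ⟨a, ha⟩ := exists_consCode n
    obtain ⟨c, d, hcd⟩ := exists_solves_of_computes a (codes n).1 (codes n).2
    refine hxA ((single_le_iff hA).2 ⟨c, d, hcd _ _ _ _ (ha x) ?_⟩)
    -- Both programs act alike for `v = 0` and `v = 1`; an output correct for both cannot be both
    -- constants, so it lies in `A`.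
    obtain ⟨z, hz, hdom, H⟩ := hv 0
    obtain ⟨z', hz', -, H'⟩ := hv 1
    obtain rfl := hz.unique hz'
    refine ⟨z, hz, hdom, fun q hq => ?_⟩
    obtain ⟨r, hr, hrA⟩ := H q hq
    obtain ⟨r', hr', hrA'⟩ := H' q hq
    obtain rfl := hr.unique hr'
    refine ⟨r, hr, ?_⟩
    rcases hrA with hrA | rfl
    · exact hrA
    · rcases hrA' with hrA' | hrA'
      · exact hrA'
      · exact absurd (congrFun hrA' 0) zero_ne_one
  choose v hv using key
  refine ⟨family (fun _ => x) fun n => A ∪ {fun _ => v n},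
    family_const_le_single hA fun n => Set.subset_union_left,
    not_family_le (fun n => hA.mono Set.subset_union_left) hv, fun hle => ?_⟩
  obtain ⟨c, d, z, hz, hdom, H⟩ := (single_le_iff hA).1 hle
  rcases mem_dom_coprod.1 hdom with ⟨w, hw, rfl⟩ | ⟨w, hw, rfl⟩
  · obtain ⟨t, ht⟩ := exists_tailCode
    exact hxA ((single_le_iff hA).2 ⟨c.subst t, d, w, hz.subst (ht 0 w), hw, by simpa using H⟩)
  · obtain ⟨n, -, rfl⟩ := mem_dom_family.1 hw
    -- The computable answer `v n` is admissible, so `x` itself computes an element of `A`.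
    obtain ⟨r, hr, hrA⟩ := H (fun _ => v n) (by
      rw [coprod_cons_one, family_cons (fun _ => x)]
      exact Or.inr rfl)
    obtain ⟨a, ha⟩ := exists_constCode (v n)
    obtain ⟨b, hb⟩ := exists_computes_join .oracle a
    exact hxA (single_le_of_turingLE hrA
      ((hb x _ _ (computes_oracle x) (ha x)).subst hr).turingLE hx)

/-- Every minimal cover of `h` is `h ⊔ point x` for some `x` that computes no instance of
`h`. -/
theorem exists_point_of_covBy {g h : Problem} (hc : h ⋖ g) :
    ∃ x, point x ≤ g ∧ ¬ point x ≤ h := by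
  obtain ⟨x, A, hA, hg, hh⟩ := exists_single_of_covBy hc
  refine ⟨x, (point_le_single hA).trans hg, fun hx => ?_⟩
  obtain ⟨k, hk, hkh, hkA⟩ := exists_between_of_point_le hA hx hh
  exact hkA (hg.trans (le_coprod_of_covBy hc (hk.trans hg) hkh))

/-! ### The minimal cover `h ⊔ point p` -/

theorem point_le_point {x y : Baire} (hxy : TuringLE y x) : point x ≤ point y :=
  point_le_iff.2 ⟨y, mem_dom_point.2 rfl, hxy⟩

theorem point_le_coprod_point {h : Problem} {x y : Baire} (hle : point x ≤ coprod h (point y)) :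
    point x ≤ h ∨ TuringLE y x := by
  obtain ⟨t, ht⟩ := exists_tailCode
  obtain ⟨z, hz, hzx⟩ := point_le_iff.1 hle
  rcases mem_dom_coprod.1 hz with ⟨w, hw, rfl⟩ | ⟨w, hw, rfl⟩
  · exact Or.inl (point_le_iff.2 ⟨w, hw, (ht 0 w).turingLE.trans hzx⟩)
  · obtain rfl := mem_dom_point.1 hw
    exact Or.inr ((ht 1 w).turingLE.trans hzx)

theorem turingLE_of_point_le {h : Problem} {p x : Baire} (hM : MedvedevLE (succSet p) h.dom)
    (hx : point x ≤ h) : TuringLE p x ∧ ¬ TuringLE x p := by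
  obtain ⟨z, hz, hzx⟩ := point_le_iff.1 hx
  obtain ⟨c, hc⟩ := medvedevLE_iff.1 hM
  obtain ⟨_, hcz, e, q, rfl, hq, hqp⟩ := hc z hz
  obtain ⟨t, ht⟩ := exists_tailCode
  have hqx : TuringLE q x := ((hcz.subst (ht e q)).turingLE).trans hzx
  have hpq : Computes (.ofIndex e) q p := mem_Φ.1 hq
  exact ⟨hpq.turingLE.trans hqx, fun h => hqp (hqx.trans h)⟩

theorem point_le_of_turingLE {h : Problem} {p x : Baire} (hM : MedvedevLE h.dom (succSet p))
    (hpx : TuringLE p x) (hxp : ¬ TuringLE x p) : point x ≤ h := by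
  obtain ⟨c, hc⟩ := turingLE_iff.1 hpx
  obtain ⟨e, rfl⟩ := OracleCode.ofIndex_surjective c
  obtain ⟨d, hd⟩ := medvedevLE_iff.1 hM
  obtain ⟨z, hz, hdom⟩ := hd (cons e x) ⟨e, x, rfl, mem_Φ.2 hc, hxp⟩
  obtain ⟨a, ha⟩ := exists_consCode e
  exact point_le_iff.2 ⟨z, hdom, ((ha x).subst hz).turingLE⟩

theorem covBy_coprod_point {h : Problem} {p : Baire} (hM : MedvedevEquiv h.dom (succSet p)) :
    h ⋖ coprod h (point p) := by
  have hph : ¬ point p ≤ h := fun hp =>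
    (turingLE_of_point_le hM.2 hp).2 (turingLE_iff.2 ⟨_, computes_oracle p⟩)
  refine ⟨⟨le_coprod_left _ _, fun hle => hph ((le_coprod_right _ _).trans hle)⟩,
    fun g hhg hg => ?_⟩
  have hpg : ¬ point p ≤ g := fun hp => hg.2 (coprod_le hhg.le hp)
  obtain ⟨c, d, hcd⟩ := le_iff.1 hg.le
  obtain ⟨t, ht⟩ := exists_tailCode
  -- `b` is an index for computing `p` from any `z` sent to the second summand, so it serves as the
  -- first entry of an element of `p⁺`.
  obtain ⟨b, hb⟩ := OracleCode.ofIndex_surjective (c.subst t)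
  obtain ⟨a, ha⟩ := exists_consCode b
  obtain ⟨m, hm⟩ := medvedevLE_iff.1 hM.1
  obtain ⟨zc, hzc⟩ := exists_constCode 0
  obtain ⟨l, hl⟩ := exists_leftCode
  obtain ⟨r, hr⟩ := exists_rightCode
  obtain ⟨u, hu⟩ := exists_computes_join l zc
  -- The first entry of `z' ⊕ z` is that of `z'`, which decides between the two summands.
  obtain ⟨j, hj⟩ := exists_computes_join c .oracle
  obtain ⟨c₁, d₁, h₁⟩ := exists_solves_of_computes r (c.subst t) d
  obtain ⟨c₂, d₂, h₂⟩ := exists_solves_of_computes r (a.subst m) (u.subst d)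
  obtain ⟨c₃, d₃, h₃⟩ := exists_solves_ite 0 c₁ d₁ c₂ d₂
  obtain ⟨c₄, d₄, h₄⟩ := exists_solves_of_computes j c₃ d₃
  refine hhg.not_ge (le_iff.2 ⟨c₄, d₄, fun z hz => ?_⟩)
  obtain ⟨z', hz', hdom, H⟩ := hcd z hz
  refine h₄ h z (join z' z) _ (hj z z' z hz' (computes_oracle z)) ?_
  rcases mem_dom_coprod.1 hdom with ⟨w, hw, rfl⟩ | ⟨w, hw, rfl⟩
  · rw [coprod_cons_zero] at H
    exact (h₃ _ _ _).1 rfl (h₁ h _ z _ (hr _ z) ⟨w, hz'.subst (ht 0 w), hw, H⟩)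
  · refine (h₃ _ _ _).2 one_ne_zero (h₂ h _ z _ (hr _ z) ?_)
    obtain rfl := mem_dom_point.1 hw
    have hzw : ¬ TuringLE z w := fun hzw => hpg (point_le_iff.2 ⟨z, hz, hzw⟩)
    obtain ⟨v, hv, hvdom⟩ := hm (cons b z) ⟨b, z, rfl, mem_Φ.2 (by
      rw [hb]
      exact hz'.subst (ht 1 w)), hzw⟩
    obtain ⟨s, hs, hsg⟩ := H (fun _ => 0) (by
      rw [coprod_cons_one]
      exact ⟨rfl, trivial⟩)
    exact ⟨v, (ha z).subst hv, hvdom, fun q _ => ⟨s, (hu _ _ _ (hl z q) (hzc _)).subst hs, hsg⟩⟩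

theorem equiv_coprod_point_of_covBy {g h : Problem} {p : Baire}
    (hM : MedvedevEquiv h.dom (succSet p)) (hc : h ⋖ g) :
    g ≤ coprod h (point p) ∧ coprod h (point p) ≤ g := by
  have hph : ¬ point p ≤ h := fun hp =>
    (turingLE_of_point_le hM.2 hp).2 (turingLE_iff.2 ⟨_, computes_oracle p⟩)
  obtain ⟨x, hxg, hxh⟩ := exists_point_of_covBy hc
  have hxp : TuringLE x p := by
    by_contra hxp
    have hpx : ¬ TuringLE p x := fun hpx => hxh (point_le_of_turingLE hM.1 hpx hxp)
    obtain ⟨y, hy, hpy⟩ := exists_not_turingLE_join hpx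
    obtain ⟨l, hl⟩ := exists_leftCode
    obtain ⟨r, hr⟩ := exists_rightCode
    have hg := le_coprod_of_covBy hc ((point_le_point (hl x y).turingLE).trans hxg)
      fun h => hpy (turingLE_of_point_le hM.2 h).1
    rcases point_le_coprod_point (hxg.trans hg) with hx | hx
    · exact hxh hx
    · exact hy ((hr x y).turingLE.trans hx)
  have hpg : point p ≤ g := (point_le_point hxp).trans hxg
  exact ⟨le_coprod_of_covBy hc hpg hph, coprod_le hc.1.le hpg⟩

theorem degree_covBy_degree {f g : Problem} : f.degree ⋖ g.degree ↔ f ⋖ g := by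
  constructor
  · rintro ⟨hlt, hno⟩
    exact ⟨toAntisymmetrization_lt_toAntisymmetrization_iff.1 hlt, fun k hfk hkg =>
      hno (c := k.degree) (toAntisymmetrization_lt_toAntisymmetrization_iff.2 hfk)
        (toAntisymmetrization_lt_toAntisymmetrization_iff.2 hkg)⟩
  · rintro ⟨hlt, hno⟩
    refine ⟨toAntisymmetrization_lt_toAntisymmetrization_iff.2 hlt, fun k => ?_⟩
    induction k using Antisymmetrization.ind with
    | _ k =>
      exact fun hfk hkg => hno (toAntisymmetrization_lt_toAntisymmetrization_iff.1 hfk)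
        (toAntisymmetrization_lt_toAntisymmetrization_iff.1 hkg)

end Problem

theorem mainTheorem8 (h : Problem)
    (hh : ∃ p : Baire, Baire.MedvedevEquiv h.dom (Baire.succSet p)) :
    ∃! a : WeihrauchDegree, h.degree ⋖ a := by
  obtain ⟨p, hM⟩ := hh
  refine ⟨(Problem.coprod h (Problem.point p)).degree,
    Problem.degree_covBy_degree.2 (Problem.covBy_coprod_point hM), fun a => ?_⟩
  induction a using Antisymmetrization.ind with
  | _ g =>
    intro hg
    exact Quotient.sound (Problem.equiv_coprod_point_of_covBy hM (Problem.degree_covBy_degree.1 hg))
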